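/- Fix a prime $p$ and integers $K\ge 1$, $d\ge 1$. A linear computation broadcast (LCBC) instance with $K$ users, data dimension $d$ and one-dimensional demands and side-information ($m=m'=1$) over $\mathbb F_q$ consists of vectors $v_k,v_k'\in\mathbb F_q^{d}$, $k=1,\dots,K$. A coding scheme consists of a batch size $L\ge 1$, a finite alphabet $\mathcal S$, an encoder $\Phi$ mapping the data $x\in\mathbb F_q^{d\times L}$ to $\Phi(x)\in\mathcal S$, and decoders $\Psi_k:\mathcal S\times\mathbb F_q^{L}\to\mathbb F_q^{L}$ (none of the maps need be linear); it is achievable if $\Psi_k(\Phi(x),x^{T}v_k')=x^{T}v_k$ for all $k$ and all $x$. Its cost is $\log_q|\mathcal S|/L$, and the optimal broadcast cost $\Delta^*$ of the instance is the infimum of the costs of all achievable schemes. Let $\Lambda_n$ be uniformly random among all such instances over $\mathbb F_{p^n}$. The generic optimal broadcast cost $\Delta_g$ is the number to which $\Delta^*(\Lambda_n)$ converges in probability as $n\to\infty$, if there is one; that is, $\lim_{n\to\infty}\Pr(|\Delta^*(\Lambda_n)-\Delta_g|<\varepsilon)=1$ for every $\varepsilon>0$. Theorem. For all $p$, $K$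 and $d$, the generic optimal broadcast cost exists and is given as follows. 1. For even $d$: $\Delta_g=d/2$ if $2\le d\le 2K$, and $\Delta_g=K$ if $d\ge 2K$. 2. For odd $d$: $\Delta_g=0$ if $d=1$; $\Delta_g=d/2$ if $3\le d<2K-1$; $\Delta_g=K-1$ if $d=2K-1$; and $\Delta_g=K$ if $d>2K-1$. -/

import Mathlib

open Filter Topology

noncomputable section

/-- An instance of linear computation broadcast over the field `F` with `K` users and data
dimension `d`. User `k` has side information `xᵀ * v' k` (of dimension `m' k`) and demands
`xᵀ * v k` (of dimension `m k`), where `x` is the data. -/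
@[ext]
structure LCBC (F : Type) (K d : ℕ) (m m' : Fin K → ℕ) where
  /-- demand coefficient matrices -/
  v : ∀ k, Matrix (Fin d) (Fin (m k)) F
  /-- side-information coefficient matrices -/
  v' : ∀ k, Matrix (Fin d) (Fin (m' k)) F

namespace LCBC

variable {F : Type} [Field F] {K d : ℕ} {m m' : Fin K → ℕ}

/-- An achievable coding scheme: a batch size `L ≥ 1`, a finite broadcast alphabet, an arbitrary
(not necessarily linear) encoder and arbitrary decoders, such that every user recovers its demand
for every realization of the data `x`, whose columns are the `L` data instances. -/
structure AchievableScheme (Λ : LCBC F K d m m') where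
  L : ℕ
  one_le_L : 1 ≤ L
  Alphabet : Type
  finite_alphabet : Finite Alphabet
  enc : Matrix (Fin d) (Fin L) F → Alphabet
  dec : ∀ k, Alphabet → Matrix (Fin L) (Fin (m' k)) F → Matrix (Fin L) (Fin (m k)) F
  decodes : ∀ (x : Matrix (Fin d) (Fin L) F) (k : Fin K),
    dec k (enc x) (x.transpose * Λ.v' k) = x.transpose * Λ.v k

/-- The broadcast cost `log_q |S| / L` of a scheme, where `q = |F|`. -/
def AchievableScheme.cost {Λ : LCBC F K d m m'} (σ : Λ.AchievableScheme) : ℝ :=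
  Real.logb (Nat.card F) (Nat.card σ.Alphabet) / σ.L

/-- The optimal broadcast cost: the infimum of the costs of all achievable schemes. -/
def optimalCost (Λ : LCBC F K d m m') : ℝ :=
  sInf (Set.range fun σ : Λ.AchievableScheme => σ.cost)

/-- The probability of an event when the instance is drawn uniformly at random among all instances
over `F` with the given dimensions. -/
def prob (F : Type) (K d : ℕ) (m m' : Fin K → ℕ) (E : Set (LCBC F K d m m')) : ℝ :=
  (E.ncard : ℝ) / (Nat.card (LCBC F K d m m') : ℝ)

/-- `Δ` is the generic optimal broadcast cost for the parameters `p, K, d, m, m'`: the optimal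
broadcast cost of a uniformly random instance over the field with `p ^ n` elements converges to
`Δ` in probability as `n → ∞`. -/
def IsGenericOptimalCost (p : ℕ) [Fact p.Prime] (K d : ℕ) (m m' : Fin K → ℕ) (Δ : ℝ) : Prop :=
  ∀ ε : ℝ, 0 < ε →
    Tendsto (fun n : ℕ => prob (GaloisField p n) K d m m' {Λ | |Λ.optimalCost - Δ| < ε})
      atTop (𝓝 1)

end LCBC

end

/-!
For the lower bounds, let `U I` be the span of all vectors of the users in a set `I`. These users
recover the data along `U I` from the broadcast and their side information, so `U I ⊓ U J` is common
information of the users in `I` and of those in `J`. Submodularity of entropy bounds the cost below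
by `dim V - (|I| + |J| + |M|) / 2` whenever `V ≤ U I ⊔ U J` and `V ≤ U M ⊔ (U I ⊓ U J)`. With
`I = J` and `M = ∅` this is `|I|` if the vectors of `I` are independent; for odd `d`, three sets of
total size `d` give `d / 2`.

The cost `d / 2` is reached asymptotically by interference alignment over `𝔽_p`. Fix `r₀`, `r₁`
independent over `𝔽_p`. The monomials with exponents less than `N` in the coordinates of all
`r_c v_k + v'_k` span a space `W` which these coordinates map into the hardly larger space `W'` with
exponents at most `N`, while `r₀ W + r₁ W` has dimension twice that of `W`. If `dim W ≈ n / 2`, the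
traces of `w x_i` for `w ∈ W'`, of cost about `d / 2`, determine the trace of `g xᵀ v_k` at user `k`
for all `g ∈ r₀ W + r₁ W`, which is almost the whole field.

If `d = 2K - 1`, the `2K` vectors satisfy a linear relation, which makes one of the `K` demands
redundant.

All genericity conditions are nonvanishing conditions on polynomials, and hold with probability
tending to one by the Schwartz–Zippel lemma. The independence of the monomials requires one such
condition for each combination with coefficients in `𝔽_p`; there are few enough of them when
`2 dim W` is slightly less than `n`.
-/

open MvPolynomial Matrix
open scoped Finset

section Counting

variable {σ ι F : Type*} [Fintype σ] [Fintype ι] [Field F] [Finite F]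

theorem ncard_eval_eq_zero_mul_card_le {P : MvPolynomial σ F} (hP : P ≠ 0) :
    {x : σ → F | eval x P = 0}.ncard * Nat.card F ≤
      P.totalDegree * Nat.card F ^ Fintype.card σ := by
  classical
  have := Fintype.ofFinite F
  let e := Fintype.equivFin σ
  have hPe : rename e P ≠ 0 := (rename_injective e e.injective).ne_iff' (map_zero _) |>.2 hP
  have hcard : {x : σ → F | eval x P = 0}.ncard =
      #{x ∈ Fintype.piFinset fun _ => (Finset.univ : Finset F) | eval x (rename e P) = 0} := by
    rw [← Set.ncard_coe_finset,
      ← Set.ncard_image_of_injective _ (Equiv.arrowCongr e (Equiv.refl F)).injective]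
    congr 1
    ext x
    simp only [Equiv.image_eq_preimage_symm, Set.mem_preimage, Set.mem_ofPred_eq, eval_rename,
      Finset.coe_filter, Fintype.mem_piFinset, Finset.mem_univ, implies_true, true_and]
    rfl
  have hbound := schwartz_zippel_totalDegree hPe Finset.univ
  have hq : (0 : ℚ≥0) < Fintype.card F := mod_cast Fintype.card_pos
  rw [← hcard, Finset.card_univ, div_le_div_iff₀ (pow_pos hq _) hq] at hbound
  rw [Nat.card_eq_fintype_card]
  exact (mod_cast hbound : _ ≤ _).trans (Nat.mul_le_mul_right _ (totalDegree_rename_le _ _))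

theorem ncard_exists_eval_eq_zero_mul_card_le {P : ι → MvPolynomial σ F} {D : ℕ}
    (hP : ∀ i, P i ≠ 0) (hD : ∀ i, (P i).totalDegree ≤ D) :
    {x : σ → F | ∃ i, eval x (P i) = 0}.ncard * Nat.card F ≤
      Fintype.card ι * D * Nat.card F ^ Fintype.card σ := by
  have hunion : {x : σ → F | ∃ i, eval x (P i) = 0}.ncard ≤
      ∑ i, {x : σ → F | eval x (P i) = 0}.ncard := by
    simpa [Set.ofPred_exists] using
      Finset.univ.set_ncard_biUnion_le fun i => {x : σ → F | eval x (P i) = 0}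
  calc _ ≤ ∑ i, {x : σ → F | eval x (P i) = 0}.ncard * Nat.card F := by
        rw [← Finset.sum_mul]; gcongr
    _ ≤ ∑ _i : ι, D * Nat.card F ^ Fintype.card σ := by
        refine Finset.sum_le_sum fun i _ => ?_
        exact (ncard_eval_eq_zero_mul_card_le (hP i)).trans (Nat.mul_le_mul_right _ (hD i))
    _ = _ := by simp [mul_assoc]

theorem ncard_not_linearIndependent_eval_mul_card_le {k : Type*} [CommRing k] [Finite k]
    [Algebra k F] {f : ι → MvPolynomial σ F} {D : ℕ} (hf : LinearIndependent k f)
    (hD : ∀ i, (f i).totalDegree ≤ D) :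
    {x : σ → F | ¬ LinearIndependent k fun i => eval x (f i)}.ncard * Nat.card F ≤
      Nat.card k ^ Fintype.card ι * D * Nat.card F ^ Fintype.card σ := by
  classical
  have := Fintype.ofFinite k
  let P : {g : ι → k // g ≠ 0} → MvPolynomial σ F := fun g => ∑ i, g.1 i • f i
  have hP (g) : P g ≠ 0 := fun h =>
    g.2 (funext (Fintype.linearIndependent_iff.1 hf g.1 h))
  have hPD (g) : (P g).totalDegree ≤ D :=
    totalDegree_finsetSum_le fun i _ => (totalDegree_smul_le _ _).trans (hD i)
  have hsub : {x : σ → F | ¬ LinearIndependent k fun i => eval x (f i)} ⊆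
      {x | ∃ g, eval x (P g) = 0} := by
    intro x hx
    obtain ⟨g, hg, i, hi⟩ := Fintype.not_linearIndependent_iff.1 hx
    refine ⟨⟨g, fun h => hi (congrFun h i)⟩, ?_⟩
    change (aeval x).restrictScalars k (∑ i, g i • f i) = 0
    simpa only [map_sum, map_smul, AlgHom.restrictScalars_apply, aeval_eq_eval] using hg
  calc _ ≤ {x | ∃ g, eval x (P g) = 0}.ncard * Nat.card F :=
        Nat.mul_le_mul_right _ (Set.ncard_le_ncard hsub)
    _ ≤ _ := ncard_exists_eval_eq_zero_mul_card_le hP hPD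
    _ ≤ _ := by
        gcongr
        simpa only [Nat.card_eq_fintype_card, Fintype.card_fun] using
          Fintype.card_subtype_le fun g : ι → k => g ≠ 0

end Counting

section CommonFunction

variable {X α β γ ζ : Type*} {A : X → α} {B : X → β} {C : X → γ} {Z : X → ζ}

theorem sum_ncard_image_fiber_le [Finite α] [Fintype γ] (hA : ∀ x y, A x = A y → C x = C y) :
    ∑ c, (A '' (C ⁻¹' {c})).ncard ≤ Nat.card α := by
  rw [← finsum_eq_sum_of_fintype, ← Set.ncard_iUnion_of_finite (fun _ => Set.toFinite _)]
  · exact Set.ncard_le_card _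
  · rintro c c' hne
    refine Set.disjoint_left.2 ?_
    rintro _ ⟨x, rfl, rfl⟩ ⟨y, rfl, hxy⟩
    exact hne (hA _ _ hxy.symm)

theorem ncard_fiber_sq_le [Finite X] [Finite ζ] (hAB : ∀ x y, A x = A y → B x = B y → x = y)
    (hCZ : ∀ x y, C x = C y → Z x = Z y → x = y) (c : γ) :
    (C ⁻¹' {c}).ncard ^ 2 ≤
      (A '' (C ⁻¹' {c})).ncard * Nat.card ζ * (B '' (C ⁻¹' {c})).ncard := by
  have hprod : (C ⁻¹' {c}).ncard ≤ (A '' (C ⁻¹' {c})).ncard * (B '' (C ⁻¹' {c})).ncard := by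
    rw [← Set.ncard_prod]
    exact Set.ncard_le_ncard_of_injOn (fun x => (A x, B x))
      (fun x hx => ⟨Set.mem_image_of_mem _ hx, Set.mem_image_of_mem _ hx⟩)
      fun x _ y _ h => hAB x y (congrArg Prod.fst h) (congrArg Prod.snd h)
  have hζ : (C ⁻¹' {c}).ncard ≤ Nat.card ζ := by
    rw [← Set.ncard_univ]
    exact Set.ncard_le_ncard_of_injOn Z (fun _ _ => Set.mem_univ _)
      fun x hx y hy => hCZ x y (hx.trans hy.symm)
  calc (C ⁻¹' {c}).ncard ^ 2 = (C ⁻¹' {c}).ncard * (C ⁻¹' {c}).ncard := sq _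
    _ ≤ (A '' (C ⁻¹' {c})).ncard * (B '' (C ⁻¹' {c})).ncard * Nat.card ζ :=
      Nat.mul_le_mul hprod hζ
    _ = _ := mul_right_comm _ _ _

/-- The combinatorial form of submodularity of entropy: `2 H(X) ≤ H(A) + H(B) + H(Z)` when `C` is
common information of `A` and `B`. -/
theorem card_sq_le_of_common_function [Finite X] [Finite α] [Finite β] [Finite ζ] [Finite γ]
    (hA : ∀ x y, A x = A y → C x = C y) (hB : ∀ x y, B x = B y → C x = C y)
    (hAB : ∀ x y, A x = A y → B x = B y → x = y)
    (hCZ : ∀ x y, C x = C y → Z x = Z y → x = y) :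
    Nat.card X ^ 2 ≤ Nat.card α * Nat.card β * Nat.card ζ := by
  have := Fintype.ofFinite γ
  have hX : Nat.card X = ∑ c, (C ⁻¹' {c}).ncard := by
    rw [← Nat.card_congr (Equiv.sigmaFiberEquiv C), Nat.card_sigma]
    rfl
  calc Nat.card X ^ 2 = (∑ c, (C ⁻¹' {c}).ncard) ^ 2 := by rw [hX]
    _ ≤ (∑ c, (A '' (C ⁻¹' {c})).ncard * Nat.card ζ) * ∑ c, (B '' (C ⁻¹' {c})).ncard :=
      Finset.sum_sq_le_sum_mul_sum_of_sq_le_mul _ (fun _ _ => Nat.zero_le _)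
        (fun _ _ => Nat.zero_le _) fun c _ => ncard_fiber_sq_le hAB hCZ c
    _ ≤ Nat.card α * Nat.card ζ * Nat.card β := by
      rw [← Finset.sum_mul]
      gcongr
      exacts [sum_ncard_image_fiber_le hA, sum_ncard_image_fiber_le hB]
    _ = _ := mul_right_comm _ _ _

end CommonFunction

section Overlap

theorem map_diagonal_sup_prod_eq_top_iff {R M : Type*} [Ring R] [AddCommGroup M] [Module R M]
    {U V W : Submodule R M} :
    U.map (LinearMap.id.prod LinearMap.id) ⊔ V.prod W = ⊤ ↔ U ⊔ V = ⊤ ∧ W ⊔ (U ⊓ V) = ⊤ := by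
  simp only [Submodule.eq_top_iff', Submodule.mem_sup, Submodule.mem_map, Submodule.mem_inf,
    Submodule.mem_prod, Prod.forall, Prod.exists]
  constructor
  · refine fun h => ⟨fun x => ?_, fun w => ?_⟩
    · obtain ⟨_, _, ⟨u, hu, ⟨⟩⟩, v, w, ⟨hv, -⟩, huv⟩ := h x 0
      exact ⟨u, hu, v, hv, congrArg Prod.fst huv⟩
    · obtain ⟨_, _, ⟨u, hu, ⟨⟩⟩, v, m, ⟨hv, hm⟩, huv⟩ := h 0 w
      have huv' : u + v = 0 := congrArg Prod.fst huv
      have hw : u + m = w := congrArg Prod.snd huv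
      refine ⟨m, hm, u, ⟨hu, ?_⟩, (add_comm _ _).trans hw⟩
      rw [eq_neg_of_add_eq_zero_left huv']
      exact neg_mem hv
  · rintro ⟨hUV, hW⟩ x y
    obtain ⟨u, hu, v, hv, rfl⟩ := hUV x
    obtain ⟨w, hw, t, ⟨htU, htV⟩, hy⟩ := hW (y - u)
    refine ⟨_, _, ⟨u + t, add_mem hu htU, rfl⟩, v - t, w, ⟨sub_mem hv htV, hw⟩, ?_⟩
    ext
    · simp
    · simp [add_assoc, add_comm t w, hy]

variable {R F ι₁ ι₂ ι₃ n : Type*}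

/-- The matrix whose rows are `(a, a)`, `(b, 0)` and `(0, c)`, for the rows `a`, `b`, `c` of three
matrices. When square, its invertibility expresses that the row spaces of `A` and `B` span the
space and that their intersection is complementary to the row space of `C`. -/
def overlapMatrix [Zero R] (A : Matrix ι₁ n R) (B : Matrix ι₂ n R) (C : Matrix ι₃ n R) :
    Matrix (ι₁ ⊕ ι₂ ⊕ ι₃) (n ⊕ n) R :=
  fromRows (fromCols A A) (fromBlocks B 0 0 C)

theorem span_row_overlapMatrix [CommRing F] (A : Matrix ι₁ n F) (B : Matrix ι₂ n F)
    (C : Matrix ι₃ n F) :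
    (Submodule.span F (Set.range (overlapMatrix A B C).row)).map
        (LinearEquiv.sumArrowLequivProdArrow n n F F).toLinearMap =
      (Submodule.span F (Set.range A.row)).map (LinearMap.id.prod LinearMap.id) ⊔
        (Submodule.span F (Set.range B.row)).prod (Submodule.span F (Set.range C.row)) := by
  have hrow : LinearEquiv.sumArrowLequivProdArrow n n F F ∘ (overlapMatrix A B C).row =
      Sum.elim (LinearMap.id.prod (LinearMap.id : (n → F) →ₗ[F] n → F) ∘ A.row)
        (Sum.elim (LinearMap.inl F _ _ ∘ B.row) (LinearMap.inr F _ _ ∘ C.row)) := by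
    ext (i | i | i) j <;> rfl
  rw [LinearMap.prod_eq_sup_map, Submodule.map_span, ← Set.range_comp, LinearEquiv.coe_coe, hrow]
  simp only [Set.Sum.elim_range, Submodule.span_union, Set.range_comp, Submodule.map_span]

theorem linearIndependent_row_overlapMatrix_iff [Field F] [Fintype ι₁] [Fintype ι₂] [Fintype ι₃]
    [Fintype n] {A : Matrix ι₁ n F} {B : Matrix ι₂ n F} {C : Matrix ι₃ n F}
    (hcard : Fintype.card ι₁ + Fintype.card ι₂ + Fintype.card ι₃ = 2 * Fintype.card n) :
    LinearIndependent F (overlapMatrix A B C).row ↔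
      Submodule.span F (Set.range A.row) ⊔ Submodule.span F (Set.range B.row) = ⊤ ∧
        Submodule.span F (Set.range C.row) ⊔
          (Submodule.span F (Set.range A.row) ⊓ Submodule.span F (Set.range B.row)) = ⊤ := by
  have hfinrank : Fintype.card (ι₁ ⊕ ι₂ ⊕ ι₃) = Module.finrank F (n ⊕ n → F) := by
    simp only [Fintype.card_sum, Module.finrank_fintype_fun_eq_card]
    lia
  rw [← map_diagonal_sup_prod_eq_top_iff, ← span_row_overlapMatrix, Submodule.map_eq_top_iff]
  exact ⟨fun h => h.span_eq_top_of_card_eq_finrank' hfinrank,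
    fun h => linearIndependent_of_top_le_span_of_card_eq_finrank h.ge hfinrank⟩

end Overlap

theorem exists_matrix_vecMul_eq {F m n : Type*} [Field F] [Fintype m] {V : Submodule F (m → F)}
    (a : V →ₗ[F] n → F) : ∃ x : Matrix m n F, ∀ w : V, w.1 ᵥ* x = a w := by
  classical
  obtain ⟨b, rfl⟩ := a.exists_extend
  exact ⟨toLinearMapRight'.symm b, fun w =>
    (toLinearMapRight'_apply _ _).symm.trans (by rw [LinearEquiv.apply_symm_apply]; rfl)⟩

section GridMonomial

variable {Y R A : Type*} [Fintype Y]

/-- The monomial `∏ y, t y ^ m y`, with exponents `m y < N`. -/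
def gridMonomial [CommMonoid A] {N : ℕ} (t : Y → A) (m : Y → Fin N) : A :=
  ∏ y, t y ^ (m y : ℕ)

theorem mul_gridMonomial [CommMonoid A] [DecidableEq Y] {N : ℕ} (t : Y → A) (m : Y → Fin N)
    (y : Y) : t y * gridMonomial t m =
      gridMonomial t (Function.update (Fin.castSucc ∘ m) y (m y).succ) := by
  simp only [gridMonomial]
  rw [← Finset.mul_prod_erase _ _ (Finset.mem_univ y),
    ← Finset.mul_prod_erase _ (fun z => t z ^ _) (Finset.mem_univ y), ← mul_assoc, ← pow_succ']
  congr 1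
  · simp
  · refine Finset.prod_congr rfl fun z hz => ?_
    simp [Finset.ne_of_mem_erase hz]

theorem map_gridMonomial {B G : Type*} [CommMonoid A] [CommMonoid B] [FunLike G A B]
    [MonoidHomClass G A B] (φ : G) {N : ℕ} (t : Y → A) (m : Y → Fin N) :
    φ (gridMonomial t m) = gridMonomial (φ ∘ t) m := by
  simp only [gridMonomial, map_prod, map_pow, Function.comp_apply]

theorem linearIndependent_gridMonomial [CommRing R] [CommRing A] [Algebra R A] {t : Y → A}
    (ht : AlgebraicIndependent R t) (N : ℕ) :
    LinearIndependent R fun m : Y → Fin N => gridMonomial t m := by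
  let e (m : Y → Fin N) : Y →₀ ℕ := Finsupp.equivFunOnFinite.symm fun y => m y
  have he : Function.Injective e := fun m m' h =>
    funext fun y => Fin.val_injective (DFunLike.congr_fun h y)
  convert ((basisMonomials Y R).linearIndependent.map_injOn (aeval t).toLinearMap
    ht.injOn).comp e he using 1
  ext m
  simp [gridMonomial, e, aeval_monomial, Finsupp.prod_fintype]

theorem totalDegree_gridMonomial_le {σ : Type*} [CommSemiring R] {N : ℕ}
    {t : Y → MvPolynomial σ R} (ht : ∀ y, (t y).totalDegree ≤ 1) (m : Y → Fin N) :
    (gridMonomial t m).totalDegree ≤ Fintype.card Y * N := by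
  refine (totalDegree_finsetProd _ _).trans (Finset.sum_le_card_nsmul _ _ _ fun y _ => ?_)
  calc (t y ^ (m y : ℕ)).totalDegree ≤ m y * (t y).totalDegree := totalDegree_pow _ _
    _ ≤ m y * 1 := Nat.mul_le_mul_left _ (ht y)
    _ ≤ N := by rw [mul_one]; exact (m y).is_lt.le

end GridMonomial

theorem exists_mul_eq_one_of_linearIndependent_row {ι n R : Type*} [Finite ι]
    [DecidableEq ι] [Fintype n] [Field R] {M : Matrix ι n R} (hM : LinearIndependent R M.row) :
    ∃ N : Matrix n ι R, M * N = 1 := by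
  classical
  have := Fintype.ofFinite ι
  obtain ⟨g, hg⟩ := M.toLinearMapRight'.exists_leftInverse_of_injective
    (LinearMap.ker_eq_bot.2 (vecMul_injective_iff.2 hM))
  exact ⟨LinearMap.toMatrixRight' g, by simpa using congrArg LinearMap.toMatrixRight' hg⟩

theorem map_overlapMatrix {R S ι₁ ι₂ ι₃ n G : Type*} [Zero R] [Zero S] [FunLike G R S]
    [ZeroHomClass G R S] (A : Matrix ι₁ n R) (B : Matrix ι₂ n R) (C : Matrix ι₃ n R) (f : G) :
    (overlapMatrix A B C).map f = overlapMatrix (A.map f) (B.map f) (C.map f) := by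
  ext (i | i | i) (j | j) <;> simp [overlapMatrix]

theorem eq_top_of_single_one_mem {R n : Type*} [Semiring R] [Finite n] [DecidableEq n]
    {V : Submodule R (n → R)} (h : ∀ i, Pi.single i 1 ∈ V) : V = ⊤ := by
  rw [eq_top_iff, ← (Pi.basisFun R n).span_eq, Submodule.span_le, Set.range_subset_iff]
  exact fun i => Pi.basisFun_apply R n i ▸ h i

section Exponents

theorem tendsto_nat_floor_rpow_inv_pow_div_half {τ : ℕ} (hτ : τ ≠ 0) (a : ℕ) :
    Tendsto (fun n : ℕ => ((⌊((n : ℝ) / 2) ^ (τ⁻¹ : ℝ)⌋₊ - a : ℕ) : ℝ) ^ τ / n) atTop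
      (𝓝 (1 / 2)) := by
  have hx : Tendsto (fun n : ℕ => ((n : ℝ) / 2) ^ (τ⁻¹ : ℝ)) atTop atTop :=
    (tendsto_rpow_atTop (by positivity)).comp
      (tendsto_natCast_atTop_atTop.atTop_div_const two_pos)
  have hfloor : Tendsto (fun x : ℝ => ((⌊x⌋₊ - a : ℕ) : ℝ) / x) atTop (𝓝 1) := by
    have h := (tendsto_nat_floor_div_atTop (R := ℝ)).sub
      ((tendsto_const_nhds (x := (a : ℝ))).div_atTop tendsto_id)
    rw [sub_zero] at h
    refine h.congr' ?_
    filter_upwards [eventually_ge_atTop (a : ℝ)] with x hx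
    rw [Nat.cast_sub (Nat.le_floor hx), sub_div, id]
  have h := ((hfloor.comp hx).pow τ).div_const 2
  rw [one_pow] at h
  refine h.congr' ?_
  filter_upwards [eventually_gt_atTop 0] with n hn
  rw [Function.comp_apply, div_pow, Real.rpow_inv_natCast_pow (by positivity) hτ]
  field_simp

theorem exists_tendsto_pow_div_half {τ : ℕ} (hτ : 2 ≤ τ) :
    ∃ N : ℕ → ℕ, Tendsto N atTop atTop ∧ (∀ᶠ n in atTop, 2 * N n ^ τ + N n ≤ n) ∧
      Tendsto (fun n => (N n : ℝ) ^ τ / n) atTop (𝓝 (1 / 2)) ∧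
      Tendsto (fun n => ((N n + 1 : ℕ) : ℝ) ^ τ / n) atTop (𝓝 (1 / 2)) := by
  have hτ₀ : τ ≠ 0 := by lia
  let M (n : ℕ) : ℕ := ⌊((n : ℝ) / 2) ^ (τ⁻¹ : ℝ)⌋₊
  have hM : Tendsto M atTop atTop :=
    (tendsto_nat_floor_atTop.comp (tendsto_rpow_atTop (by positivity))).comp
      (tendsto_natCast_atTop_atTop.atTop_div_const two_pos)
  have hpow (n) : 2 * M n ^ τ ≤ n := by
    have h : (M n : ℝ) ^ τ ≤ n / 2 := by
      calc (M n : ℝ) ^ τ ≤ (((n : ℝ) / 2) ^ (τ⁻¹ : ℝ)) ^ τ := by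
            gcongr
            exact Nat.floor_le (by positivity)
        _ = n / 2 := Real.rpow_inv_natCast_pow (by positivity) hτ₀
    rw [le_div_iff₀' two_pos] at h
    exact_mod_cast h
  refine ⟨fun n => M n - 1, (tendsto_sub_atTop_nat 1).comp hM, ?_,
    tendsto_nat_floor_rpow_inv_pow_div_half hτ₀ 1,
    (tendsto_nat_floor_rpow_inv_pow_div_half hτ₀ 0).congr' ?_⟩
  · filter_upwards [hM.eventually_ge_atTop 1] with n hn
    obtain ⟨N, hN⟩ : ∃ N, M n = N + 1 := ⟨M n - 1, by lia⟩
    obtain ⟨t, rfl⟩ : ∃ t, τ = t + 2 := ⟨τ - 2, by lia⟩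
    have hle : N ^ (t + 2) + N ≤ (N + 1) ^ (t + 2) := by
      calc N ^ (t + 2) + N ≤ (N + 1) ^ (t + 1) * N + (N + 1) ^ (t + 1) := by
            rw [pow_succ]
            gcongr
            · exact N.le_succ
            · exact N.le_succ.trans (Nat.le_self_pow (by simp) _)
        _ = (N + 1) ^ (t + 2) := by ring
    have := hpow n
    simp only [hN, Nat.add_sub_cancel] at this ⊢
    lia
  · filter_upwards [hM.eventually_ge_atTop 1] with n hn
    simp only [M, Nat.sub_add_cancel hn, Nat.sub_zero]

end Exponents

noncomputable section

namespace LCBC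

section Scheme

variable {F : Type} [Field F] {K d : ℕ} {m m' : Fin K → ℕ} {Λ : LCBC F K d m m'}

/-- The achievable scheme with a given encoder, when any two data with the same broadcast and the
same side information at a user also have the same demand there. -/
def AchievableScheme.ofEncoder {L : ℕ} (hL : 1 ≤ L) {S : Type} [Finite S]
    (enc : Matrix (Fin d) (Fin L) F → S)
    (henc : ∀ k x y, enc x = enc y → xᵀ * Λ.v' k = yᵀ * Λ.v' k → xᵀ * Λ.v k = yᵀ * Λ.v k) :
    Λ.AchievableScheme where
  L := L
  one_le_L := hL
  Alphabet := S
  finite_alphabet := inferInstance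
  enc := enc
  dec k s y := Function.extend (fun x => (enc x, xᵀ * Λ.v' k)) (fun x => xᵀ * Λ.v k) 0 (s, y)
  decodes x k := Function.FactorsThrough.extend_apply
    (fun x y hxy => henc k x y (congrArg Prod.fst hxy) (congrArg Prod.snd hxy)) 0 x

variable [Finite F]

theorem AchievableScheme.cost_nonneg (σ : Λ.AchievableScheme) : 0 ≤ σ.cost := by
  have := σ.finite_alphabet
  have hq : (1 : ℝ) < Nat.card F := mod_cast Finite.one_lt_card
  rcases (Nat.card σ.Alphabet).eq_zero_or_pos with h | h
  · simp [cost, h]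
  · exact div_nonneg (Real.logb_nonneg hq (mod_cast h)) (Nat.cast_nonneg _)

theorem optimalCost_le_cost (σ : Λ.AchievableScheme) : Λ.optimalCost ≤ σ.cost :=
  csInf_le ⟨0, Set.forall_mem_range.2 fun τ => τ.cost_nonneg⟩ (Set.mem_range_self σ)

theorem le_optimalCost {c : ℝ} (h : ∀ σ : Λ.AchievableScheme, c ≤ σ.cost) : c ≤ Λ.optimalCost :=
  have : Nonempty Λ.AchievableScheme :=
    ⟨.ofEncoder le_rfl id fun _ _ _ hxy _ => congrArg (fun x => xᵀ * Λ.v _) hxy⟩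
  le_csInf (Set.range_nonempty _) (Set.forall_mem_range.2 h)

theorem optimalCost_nonneg : 0 ≤ Λ.optimalCost := le_optimalCost fun σ => σ.cost_nonneg

end Scheme

/-- Instances with one-dimensional demands and side information. -/
abbrev ScalarLCBC (F : Type) (K d : ℕ) : Type := LCBC F K d (fun _ => 1) (fun _ => 1)

section Vec

variable {F : Type} {K d : ℕ}

/-- The demand vector (`true`) or the side-information vector (`false`) of a user. -/
def vec (Λ : ScalarLCBC F K d) : Fin K × Bool → Fin d → F
  | (k, true) => fun i => Λ.v k i 0
  | (k, false) => fun i => Λ.v' k i 0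

variable [Field F] {Λ : ScalarLCBC F K d} {L : ℕ} {x y : Matrix (Fin d) (Fin L) F} {k : Fin K}

theorem transpose_mul_v_eq_iff :
    xᵀ * Λ.v k = yᵀ * Λ.v k ↔ Λ.vec (k, true) ᵥ* x = Λ.vec (k, true) ᵥ* y := by
  have hentry (z : Matrix (Fin d) (Fin L) F) (l : Fin L) :
      (zᵀ * Λ.v k) l 0 = (Λ.vec (k, true) ᵥ* z) l := by
    simp only [mul_apply, vecMul, dotProduct, transpose_apply, vec, mul_comm]
  simp only [← Matrix.ext_iff, Fin.forall_fin_one, hentry, funext_iff]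

theorem transpose_mul_v'_eq_iff :
    xᵀ * Λ.v' k = yᵀ * Λ.v' k ↔ Λ.vec (k, false) ᵥ* x = Λ.vec (k, false) ᵥ* y := by
  have hentry (z : Matrix (Fin d) (Fin L) F) (l : Fin L) :
      (zᵀ * Λ.v' k) l 0 = (Λ.vec (k, false) ᵥ* z) l := by
    simp only [mul_apply, vecMul, dotProduct, transpose_apply, vec, mul_comm]
  simp only [← Matrix.ext_iff, Fin.forall_fin_one, hentry, funext_iff]

end Vec

section Converse

variable {F : Type} [Field F] {K d : ℕ} {Λ : ScalarLCBC F K d}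

/-- The space of the vectors `w` on which two data `x` and `y` agree: `wᵀ x = wᵀ y`. -/
def agreement {L : ℕ} (x y : Matrix (Fin d) (Fin L) F) : Submodule F (Fin d → F) :=
  LinearMap.eqLocus x.vecMulLinear y.vecMulLinear

/-- The matrix whose rows are the demand and side-information vectors, taken from an array `w`, of
a set of users. The entries of `w` may be those of an instance or indeterminates. -/
def userRows {R : Type*} (w : Fin K × Bool → Fin d → R) (I : Finset (Fin K)) :
    Matrix (I × Bool) (Fin d) R :=
  of fun u => w (u.1, u.2)

/-- The space spanned by the demand and side-information vectors of a set of users. -/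
def userSpan (Λ : ScalarLCBC F K d) (I : Finset (Fin K)) : Submodule F (Fin d → F) :=
  Submodule.span F (Set.range (userRows Λ.vec I).row)

theorem AchievableScheme.userSpan_le_agreement (σ : Λ.AchievableScheme)
    {x y : Matrix (Fin d) (Fin σ.L) F} (henc : σ.enc x = σ.enc y) {I : Finset (Fin K)}
    (hside : ∀ k : I, Λ.vec (k, false) ᵥ* x = Λ.vec (k, false) ᵥ* y) :
    Λ.userSpan I ≤ agreement x y := by
  rw [userSpan, Submodule.span_le, Set.range_subset_iff]
  rintro ⟨k, _ | _⟩
  · exact hside k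
  · refine transpose_mul_v_eq_iff.1 ?_
    rw [← σ.decodes, ← σ.decodes, henc, transpose_mul_v'_eq_iff.2 (hside k)]

variable [Finite F]

theorem AchievableScheme.card_pow_le (σ : Λ.AchievableScheme) {I J M : Finset (Fin K)}
    {V : Submodule F (Fin d → F)} (hV : V ≤ Λ.userSpan I ⊔ Λ.userSpan J)
    (hV' : V ≤ Λ.userSpan M ⊔ (Λ.userSpan I ⊓ Λ.userSpan J)) :
    Nat.card F ^ (2 * Module.finrank F V * σ.L) ≤
      Nat.card σ.Alphabet ^ 2 * Nat.card F ^ ((#I + #J + #M) * σ.L) := by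
  have := σ.finite_alphabet
  let W := Λ.userSpan I ⊓ Λ.userSpan J
  choose x hx using fun a : V →ₗ[F] Fin σ.L → F => exists_matrix_vecMul_eq a
  let A (I : Finset (Fin K)) (a : V →ₗ[F] Fin σ.L → F) : σ.Alphabet × (I → Fin σ.L → F) :=
    (σ.enc (x a), fun k => Λ.vec (k, false) ᵥ* x a)
  let C (a : V →ₗ[F] Fin σ.L → F) : σ.Alphabet × (W →ₗ[F] Fin σ.L → F) :=
    (σ.enc (x a), (x a).vecMulLinear ∘ₗ W.subtype)
  have hA {I a b} (h : A I a = A I b) : Λ.userSpan I ≤ agreement (x a) (x b) :=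
    σ.userSpan_le_agreement (congrArg Prod.fst h) (congrFun (congrArg Prod.snd h))
  have hC {I a b} (h : A I a = A I b) (hW : W ≤ agreement (x a) (x b)) : C a = C b :=
    Prod.ext (congrArg Prod.fst h :) (LinearMap.ext fun w => hW w.2)
  have hinj {a b} (h : V ≤ agreement (x a) (x b)) : a = b :=
    LinearMap.ext fun w => (hx a w).symm.trans ((h w.2).trans (hx b w))
  have : Finite (V →ₗ[F] Fin σ.L → F) := Module.finite_of_finite F
  have : Finite (W →ₗ[F] Fin σ.L → F) := Module.finite_of_finite F
  have hle := card_sq_le_of_common_function (A := A I) (B := A J) (C := C)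
    (Z := fun a (k : M) => Λ.vec (k, false) ᵥ* x a)
    (fun _ _ h => hC h (inf_le_left.trans (hA h)))
    (fun _ _ h => hC h (inf_le_right.trans (hA h)))
    (fun _ _ h h' => hinj (hV.trans (sup_le (hA h) (hA h'))))
    (fun _ _ h h' => hinj (hV'.trans (sup_le (hA (Prod.ext (congrArg Prod.fst h :) h'))
      fun w hw => LinearMap.congr_fun (congrArg Prod.snd h) ⟨w, hw⟩)))
  have hside (I : Finset (Fin K)) : Nat.card (I → Fin σ.L → F) = Nat.card F ^ (#I * σ.L) := by
    rw [Nat.card_fun, Nat.card_fun, Nat.card_fin, ← pow_mul, mul_comm,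
      Nat.card_eq_fintype_card (α := I), Fintype.card_coe]
  have hdata : Nat.card (V →ₗ[F] Fin σ.L → F) = Nat.card F ^ (Module.finrank F V * σ.L) := by
    rw [Module.natCard_eq_pow_finrank (K := F), Module.finrank_linearMap,
      Module.finrank_fin_fun]
  rw [hdata, Nat.card_prod, Nat.card_prod, hside, hside, hside] at hle
  refine (Eq.le ?_).trans (hle.trans (Eq.le ?_)) <;> ring

theorem finrank_sub_card_div_two_le_optimalCost {I J M : Finset (Fin K)}
    {V : Submodule F (Fin d → F)} (hV : V ≤ Λ.userSpan I ⊔ Λ.userSpan J)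
    (hV' : V ≤ Λ.userSpan M ⊔ (Λ.userSpan I ⊓ Λ.userSpan J)) :
    (Module.finrank F V : ℝ) - (#I + #J + #M) / 2 ≤ Λ.optimalCost := by
  refine le_optimalCost fun σ => ?_
  have := σ.finite_alphabet
  have hq : (1 : ℝ) < Nat.card F := mod_cast Finite.one_lt_card
  have hL : (0 : ℝ) < σ.L := mod_cast σ.one_le_L
  have hS : (0 : ℝ) < Nat.card σ.Alphabet := mod_cast Nat.card_pos_iff.2 ⟨⟨σ.enc 0⟩, inferInstance⟩
  have hlog := Real.logb_le_logb_of_le hq (by positivity)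
    (show (Nat.card F : ℝ) ^ (2 * Module.finrank F V * σ.L) ≤
      Nat.card σ.Alphabet ^ 2 * Nat.card F ^ ((#I + #J + #M) * σ.L) by
        exact_mod_cast σ.card_pow_le hV hV')
  rw [Real.logb_mul (by positivity) (by positivity)] at hlog
  simp only [Real.logb_pow, Real.logb_self_eq_one hq, mul_one] at hlog
  push_cast at hlog
  rw [AchievableScheme.cost, le_div_iff₀ hL]
  linarith

theorem card_le_optimalCost {I : Finset (Fin K)}
    (hI : LinearIndependent F (userRows Λ.vec I).row) : (#I : ℝ) ≤ Λ.optimalCost := by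
  have h := finrank_sub_card_div_two_le_optimalCost (I := I) (J := I) (M := ∅)
    (V := Λ.userSpan I) le_sup_left (by rw [inf_idem]; exact le_sup_right)
  rw [userSpan, finrank_span_eq_card hI, Fintype.card_prod, Fintype.card_bool, Fintype.card_coe,
    Finset.card_empty] at h
  push_cast at h
  linarith

theorem half_le_optimalCost {I J M : Finset (Fin K)} (hcard : #I + #J + #M = d)
    (h : LinearIndependent F
      (overlapMatrix (userRows Λ.vec I) (userRows Λ.vec J) (userRows Λ.vec M)).row) :
    (d : ℝ) / 2 ≤ Λ.optimalCost := by
  obtain ⟨hIJ, hM⟩ := (linearIndependent_row_overlapMatrix_iff (by simp; lia)).1 h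
  have h := finrank_sub_card_div_two_le_optimalCost hIJ.ge hM.ge
  rw [finrank_top, Module.finrank_fin_fun] at h
  have hcard : (#I + #J + #M : ℝ) = d := mod_cast hcard
  linarith

end Converse

section LinearScheme

variable {F : Type} [Field F] [Finite F] {K d : ℕ} {Λ : ScalarLCBC F K d}

theorem optimalCost_le_finrank_div_finrank {k S : Type} [Field k] [Algebra k F] [AddCommGroup S]
    [Module k S] [Module.Finite k S] (enc : (Fin d → F) →ₗ[k] S)
    (henc : ∀ z, enc z = 0 → ∀ j, Λ.vec (j, false) ⬝ᵥ z = 0 → Λ.vec (j, true) ⬝ᵥ z = 0) :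
    Λ.optimalCost ≤ Module.finrank k S / Module.finrank k F := by
  have : Finite k := Finite.of_injective _ (algebraMap k F).injective
  have : Finite S := Module.finite_of_finite k
  have hvec (j b) (x y : Matrix (Fin d) (Fin 1) F) :
      Λ.vec (j, b) ᵥ* x = Λ.vec (j, b) ᵥ* y ↔ Λ.vec (j, b) ⬝ᵥ (x.col 0 - y.col 0) = 0 := by
    rw [dotProduct_sub, sub_eq_zero, funext_iff, Fin.forall_fin_one]
    rfl
  let σ : Λ.AchievableScheme := .ofEncoder le_rfl (fun x => enc (x.col 0)) <| by
    intro j x y hxy hside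
    rw [transpose_mul_v'_eq_iff, hvec] at hside
    rw [transpose_mul_v_eq_iff, hvec]
    exact henc _ (by rw [map_sub, sub_eq_zero]; exact hxy) j hside
  have hk : (1 : ℝ) < Nat.card k := mod_cast Finite.one_lt_card
  calc Λ.optimalCost ≤ σ.cost := optimalCost_le_cost σ
    _ = Real.logb (Nat.card F) (Nat.card S) / (1 : ℕ) := rfl
    _ = Module.finrank k S / Module.finrank k F := by
      rw [Module.natCard_eq_pow_finrank (K := k) (V := S),
        Module.natCard_eq_pow_finrank (K := k) (V := F), Nat.cast_one, div_one, Real.logb]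
      push_cast
      rw [Real.log_pow, Real.log_pow, mul_div_mul_right _ _ (Real.log_pos hk).ne']

theorem optimalCost_le_card_users : Λ.optimalCost ≤ K := by
  have h := optimalCost_le_finrank_div_finrank (Λ := Λ)
    (LinearMap.pi fun j => dotProductBilin F F (Λ.vec (j, true))) fun z hz j _ => congrFun hz j
  simpa using h

theorem optimalCost_eq_zero_of_mem_span
    (h : ∀ j, Λ.vec (j, true) ∈ Submodule.span F {Λ.vec (j, false)}) : Λ.optimalCost = 0 := by
  refine le_antisymm ?_ optimalCost_nonneg
  have hcost := optimalCost_le_finrank_div_finrank (Λ := Λ) (0 : (Fin d → F) →ₗ[F] Fin 0 → F)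
    fun z _ j hj => by
      obtain ⟨a, ha⟩ := Submodule.mem_span_singleton.1 (h j)
      rw [← ha, smul_dotProduct, hj, smul_zero]
  simpa using hcost

theorem optimalCost_le_card_users_sub_one_of_sum_eq_zero (j₀ : Fin K) {c : Fin K × Bool → F}
    (hsum : ∑ u, c u • Λ.vec u = 0) (hc : ∀ j, c (j, true) ≠ 0) : Λ.optimalCost ≤ K - 1 := by
  let w (j : Fin K) : Fin d → F := c (j, true) • Λ.vec (j, true) + c (j, false) • Λ.vec (j, false)
  have hw : ∑ j, w j = 0 := by
    simpa only [Fintype.sum_prod_type, Fintype.sum_bool] using hsum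
  have hcost := optimalCost_le_finrank_div_finrank (Λ := Λ)
    (LinearMap.pi fun j : {j // j ≠ j₀} => dotProductBilin F F (w j)) fun z hz j hj => by
      have hne (i) (hi : i ≠ j₀) : w i ⬝ᵥ z = 0 := congrFun hz ⟨i, hi⟩
      have hwz (i) : w i ⬝ᵥ z = 0 := by
        by_cases hi : i = j₀
        · rw [hi, ← zero_dotProduct z, ← hw, sum_dotProduct]
          exact (Finset.sum_eq_single_of_mem _ (Finset.mem_univ _) fun i _ => hne i).symm
        · exact hne i hi
      have hwj := hwz j
      rw [add_dotProduct, smul_dotProduct, smul_dotProduct, hj, smul_zero, add_zero] at hwj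
      exact (mul_eq_zero.1 hwj).resolve_left (hc j)
  have hK : 1 ≤ K := j₀.pos
  simpa [hK] using hcost

theorem optimalCost_le_card_users_sub_one (hK : 1 ≤ K) (hd : d < 2 * K)
    (h : ∀ j : Fin K, LinearIndepOn F Λ.vec ({(j, true)}ᶜ : Finset (Fin K × Bool))) :
    Λ.optimalCost ≤ K - 1 := by
  have hdep : ¬ LinearIndependent F Λ.vec := fun h => by
    have := h.fintype_card_le_finrank
    simp only [Fintype.card_prod, Fintype.card_fin, Fintype.card_bool,
      Module.finrank_fin_fun] at this
    lia
  obtain ⟨c, hsum, u, hu⟩ := Fintype.not_linearIndependent_iff.1 hdep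
  refine optimalCost_le_card_users_sub_one_of_sum_eq_zero ⟨0, hK⟩ hsum fun j hj => hu ?_
  by_cases huj : u = (j, true)
  · rw [huj, hj]
  · refine linearIndepOn_finset_iff.1 (h j) c ?_ u (by simpa using huj)
    rwa [← Finset.sum_add_sum_compl {(j, true)}, Finset.sum_singleton, hj, zero_smul,
      zero_add] at hsum

end LinearScheme

section AlignedScalars

variable {F : Type} [Field F] {K d : ℕ} {Λ : ScalarLCBC F K d} {k : Type} [Field k] [Algebra k F]

/-- The scalars `g` for which some combination `g v_j + b v'_j` of the vectors of user `j` has all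
its coordinates in the subspace `W`. The trace of `g` times the demand of user `j` can then be
computed from the traces of `w x_i` for `w ∈ W`, which are the same for all users. -/
def alignedScalars (Λ : ScalarLCBC F K d) (W : Submodule k F) (j : Fin K) : Submodule k F where
  carrier := {g | ∃ b, ∀ i, g * Λ.vec (j, true) i + b * Λ.vec (j, false) i ∈ W}
  zero_mem' := ⟨0, fun i => by simp⟩
  add_mem' := by
    rintro g g' ⟨b, hb⟩ ⟨b', hb'⟩
    exact ⟨b + b', fun i => by simpa only [add_mul, add_add_add_comm] using add_mem (hb i) (hb' i)⟩
  smul_mem' := by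
    rintro a g ⟨b, hb⟩
    exact ⟨a • b, fun i => by simpa only [smul_mul_assoc, smul_add] using W.smul_mem a (hb i)⟩

theorem trace_mul_eq_zero_of_mem_alignedScalars {W : Submodule k F} {j : Fin K} {g : F}
    (hg : g ∈ Λ.alignedScalars W j) {z : Fin d → F}
    (hW : ∀ i, ∀ w ∈ W, Algebra.trace k F (z i * w) = 0) (hj : Λ.vec (j, false) ⬝ᵥ z = 0) :
    Algebra.trace k F ((Λ.vec (j, true) ⬝ᵥ z) * g) = 0 := by
  obtain ⟨b, hb⟩ := hg
  have hsum : (Λ.vec (j, true) ⬝ᵥ z) * g =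
      ∑ i, z i * (g * Λ.vec (j, true) i + b * Λ.vec (j, false) i) := by
    calc _ = (Λ.vec (j, true) ⬝ᵥ z) * g + (Λ.vec (j, false) ⬝ᵥ z) * b := by
          rw [hj, zero_mul, add_zero]
      _ = _ := by
          simp only [dotProduct, Finset.sum_mul, ← Finset.sum_add_distrib]
          exact Finset.sum_congr rfl fun i _ => by ring
  rw [hsum, map_sum]
  exact Finset.sum_eq_zero fun i _ => hW i _ (hb i)

theorem optimalCost_le_of_alignedScalars [Finite F] (W : Submodule k F) :
    Λ.optimalCost ≤ (d * Module.finrank k W +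
      ∑ j, Module.finrank k (F ⧸ Λ.alignedScalars W j) : ℕ) / Module.finrank k F := by
  have : Finite k := Finite.of_injective _ (algebraMap k F).injective
  choose C hC using fun j => (Λ.alignedScalars W j).exists_isCompl
  let enc : (Fin d → F) →ₗ[k] (Fin d → Module.Dual k W) × ∀ j, Module.Dual k (C j) :=
    (LinearMap.pi fun i => (Algebra.traceForm k F).domRestrict₂ W ∘ₗ LinearMap.proj i).prod
      (LinearMap.pi fun j =>
        (Algebra.traceForm k F).domRestrict₂ (C j) ∘ₗ dotProductBilin k k (Λ.vec (j, true)))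
  have hcost := optimalCost_le_finrank_div_finrank (Λ := Λ) enc fun z hz j hj => by
    have hW (i : Fin d) (w) (hw : w ∈ W) : Algebra.trace k F (z i * w) = 0 :=
      LinearMap.congr_fun (congrFun (congrArg Prod.fst hz) i) ⟨w, hw⟩
    have hCj (c) (hc : c ∈ C j) : Algebra.trace k F ((Λ.vec (j, true) ⬝ᵥ z) * c) = 0 :=
      LinearMap.congr_fun (congrFun (congrArg Prod.snd hz) j) ⟨c, hc⟩
    refine (traceForm_nondegenerate k F).1 _ fun g => ?_
    obtain ⟨a, ha, c, hc, rfl⟩ :=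
      Submodule.mem_sup.1 ((hC j).sup_eq_top ▸ Submodule.mem_top (x := g))
    rw [Algebra.traceForm_apply, mul_add, map_add, hCj c hc,
      trace_mul_eq_zero_of_mem_alignedScalars ha hW hj, add_zero]
  refine hcost.trans_eq ?_
  congr 2
  simp only [Module.finrank_prod, Module.finrank_pi_fintype, Subspace.dual_finrank_eq,
    Finset.sum_const, Finset.card_univ, Fintype.card_fin, smul_eq_mul]
  congr! 3 with j
  exact (Submodule.quotientEquivOfIsCompl _ _ (hC j)).finrank_eq.symm

end AlignedScalars

section Mix

variable {K d : ℕ}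

/-- The coordinates of the combinations `r c • v_j + v'_j` of the vectors of each user `j`, where
`x` lists the coordinates of the `v_j` and `v'_j`. -/
def mix {R : Type*} [Semiring R] (r : Fin 2 → R) (x : (Fin K × Bool) × Fin d → R)
    (y : (Fin K × Fin 2) × Fin d) : R :=
  r y.1.2 * x ((y.1.1, true), y.2) + x ((y.1.1, false), y.2)

theorem map_comp_mix {R S : Type*} [Semiring R] [Semiring S] (φ : R →+* S) (r : Fin 2 → R)
    (x : (Fin K × Bool) × Fin d → R) : φ ∘ mix r x = mix (φ ∘ r) (φ ∘ x) := by
  ext y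
  simp only [mix, Function.comp_apply, map_add, map_mul]

theorem totalDegree_mix_le {R : Type*} [CommSemiring R] (r : Fin 2 → R)
    (y : (Fin K × Fin 2) × Fin d) : (mix (C ∘ r) X y : MvPolynomial _ R).totalDegree ≤ 1 := by
  rcases subsingleton_or_nontrivial R with _ | _
  · rw [Subsingleton.elim (mix (C ∘ r) X y) 0, totalDegree_zero]
    exact zero_le_one
  refine (totalDegree_add _ _).trans (max_le ((totalDegree_mul _ _).trans ?_) (totalDegree_X _).le)
  rw [Function.comp_apply, totalDegree_C, totalDegree_X, zero_add]

theorem algebraicIndependent_mix {F : Type*} [Field F] {r : Fin 2 → F} (hr : r 0 ≠ r 1) :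
    AlgebraicIndependent F (mix (K := K) (d := d) (C ∘ r) X) := by
  let slope (j : Fin K) (i : Fin d) : MvPolynomial ((Fin K × Fin 2) × Fin d) F :=
    C (r 1 - r 0)⁻¹ * (X ((j, 1), i) - X ((j, 0), i))
  let s : (Fin K × Bool) × Fin d → MvPolynomial ((Fin K × Fin 2) × Fin d) F
    | ((j, true), i) => slope j i
    | ((j, false), i) => X ((j, 0), i) - C (r 0) * slope j i
  have hslope (j i) : (C (r 1) - C (r 0)) * slope j i = X ((j, 1), i) - X ((j, 0), i) := by
    rw [← C_sub, ← mul_assoc, ← C_mul, mul_inv_cancel₀ (sub_ne_zero.2 hr.symm), C_1, one_mul]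
  have hs : aeval (R := F) s ∘ mix (C ∘ r) X = X := by
    ext1 ⟨⟨j, c⟩, i⟩
    simp only [Function.comp_apply, mix, map_add, map_mul, algHom_C, algebraMap_eq, aeval_X, s]
    match c with
    | 0 => ring
    | 1 => linear_combination hslope j i
  refine AlgebraicIndependent.of_comp (aeval s) ?_
  rw [hs]
  exact algebraicIndependent_X _ _

theorem linearIndependent_C_mul_gridMonomial_mix {k F : Type*} [Field k] [Field F] [Algebra k F]
    {r : Fin 2 → F} (hr : LinearIndependent k r) (N : ℕ) :
    LinearIndependent k fun u : Fin 2 × ((Fin K × Fin 2) × Fin d → Fin N) =>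
      C (r u.1) * gridMonomial (mix (C ∘ r) X) u.2 := by
  simp only [← smul_eq_C_mul]
  exact linearIndependent_smul hr (linearIndependent_gridMonomial
    (algebraicIndependent_mix (hr.injective.ne zero_ne_one)) N)

end Mix

section Alignment

variable {F : Type} {K d : ℕ}

/-- An instance as a point of affine space. -/
def coord (Λ : ScalarLCBC F K d) (u : (Fin K × Bool) × Fin d) : F := Λ.vec u.1 u.2

variable [Field F] {Λ : ScalarLCBC F K d} {k : Type} [Field k] [Algebra k F]

variable (k) in
/-- The space in which the demands are aligned, spanned by the monomials of degree less than `N` in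
each of the mixed coordinates. -/
def mixSpan (Λ : ScalarLCBC F K d) (r : Fin 2 → F) (N : ℕ) : Submodule k F :=
  Submodule.span k (Set.range fun m : (Fin K × Fin 2) × Fin d → Fin N =>
    gridMonomial (mix r Λ.coord) m)

theorem mul_gridMonomial_mem_alignedScalars (r : Fin 2 → F) {N : ℕ} (j : Fin K) (c : Fin 2)
    (m : (Fin K × Fin 2) × Fin d → Fin N) :
    r c * gridMonomial (mix r Λ.coord) m ∈ Λ.alignedScalars (Λ.mixSpan k r (N + 1)) j := by
  refine ⟨gridMonomial (mix r Λ.coord) m, fun i => Submodule.subset_span ⟨_,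
    (mul_gridMonomial (mix r Λ.coord) m ((j, c), i)).symm.trans ?_⟩⟩
  simp only [mix, coord]
  ring

theorem finrank_mixSpan_le (r : Fin 2 → F) (N : ℕ) :
    Module.finrank k (Λ.mixSpan k r N) ≤ N ^ Fintype.card ((Fin K × Fin 2) × Fin d) := by
  refine (finrank_range_le_card _).trans_eq ?_
  rw [Fintype.card_fun, Fintype.card_fin]

variable [Finite F]

theorem two_mul_pow_le_finrank_alignedScalars {r : Fin 2 → F} {N : ℕ}
    (h : LinearIndependent k fun u : Fin 2 × ((Fin K × Fin 2) × Fin d → Fin N) =>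
      r u.1 * gridMonomial (mix r Λ.coord) u.2) (j : Fin K) :
    2 * N ^ Fintype.card ((Fin K × Fin 2) × Fin d) ≤
      Module.finrank k (Λ.alignedScalars (Λ.mixSpan k r (N + 1)) j) := by
  have := Module.Finite.of_finite (R := k) (M := F)
  have hle : Submodule.span k (Set.range fun u : Fin 2 × ((Fin K × Fin 2) × Fin d → Fin N) =>
      r u.1 * gridMonomial (mix r Λ.coord) u.2) ≤ Λ.alignedScalars (Λ.mixSpan k r (N + 1)) j :=
    Submodule.span_le.2 (Set.range_subset_iff.2 fun u =>
      mul_gridMonomial_mem_alignedScalars r j u.1 u.2)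
  refine (Eq.symm ?_).trans_le (Submodule.finrank_mono hle)
  rw [finrank_span_eq_card h, Fintype.card_prod, Fintype.card_fun, Fintype.card_fin,
    Fintype.card_fin]

theorem optimalCost_le_of_linearIndependent_gridMonomial {r : Fin 2 → F} {N : ℕ}
    (h : LinearIndependent k fun u : Fin 2 × ((Fin K × Fin 2) × Fin d → Fin N) =>
      r u.1 * gridMonomial (mix r Λ.coord) u.2) :
    Λ.optimalCost ≤
      d * (((N + 1 : ℕ) : ℝ) ^ Fintype.card ((Fin K × Fin 2) × Fin d) / Module.finrank k F) +
        K * (1 - 2 * ((N : ℝ) ^ Fintype.card ((Fin K × Fin 2) × Fin d) / Module.finrank k F)) := by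
  have := Module.Finite.of_finite (R := k) (M := F)
  set τ := Fintype.card ((Fin K × Fin 2) × Fin d)
  let W := Λ.mixSpan k r (N + 1)
  have hW : (Module.finrank k W : ℝ) ≤ ((N + 1 : ℕ) : ℝ) ^ τ := mod_cast finrank_mixSpan_le r _
  have hquot (j) : (Module.finrank k (F ⧸ Λ.alignedScalars W j) : ℝ) ≤
      Module.finrank k F - 2 * (N : ℝ) ^ τ := by
    have haligned : 2 * (N : ℝ) ^ τ ≤ Module.finrank k (Λ.alignedScalars W j) :=
      mod_cast two_mul_pow_le_finrank_alignedScalars h j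
    rw [← (Λ.alignedScalars W j).finrank_quotient_add_finrank, Nat.cast_add]
    linarith
  have hn : (0 : ℝ) < Module.finrank k F := mod_cast Module.finrank_pos
  calc Λ.optimalCost
      ≤ (d * Module.finrank k W + ∑ j, Module.finrank k (F ⧸ Λ.alignedScalars W j) : ℕ) /
        Module.finrank k F := optimalCost_le_of_alignedScalars W
    _ ≤ (d * ((N + 1 : ℕ) : ℝ) ^ τ + K * (Module.finrank k F - 2 * (N : ℝ) ^ τ)) /
        Module.finrank k F := by
      push_cast at hW ⊢
      gcongr
      simpa using Finset.sum_le_card_nsmul Finset.univ _ _ fun j _ => hquot j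
    _ = _ := by field_simp

end Alignment

section Prob

variable {F : Type} {K d : ℕ} {m m' : Fin K → ℕ}

instance [Finite F] : Finite (LCBC F K d m m') :=
  Finite.of_injective (fun Λ => (Λ.v, Λ.v')) fun _ _ h =>
    LCBC.ext (congrArg Prod.fst h) (congrArg Prod.snd h)

instance [Nonempty F] : Nonempty (LCBC F K d m m') :=
  ⟨⟨fun _ => of fun _ _ => Classical.arbitrary F, fun _ => of fun _ _ => Classical.arbitrary F⟩⟩

theorem coord_bijective : Function.Bijective (coord : ScalarLCBC F K d → _) := by
  refine ⟨fun Λ Λ' h => ?_, fun x => ⟨⟨fun j => of fun i _ => x ((j, true), i),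
    fun j => of fun i _ => x ((j, false), i)⟩, ?_⟩⟩
  · ext j i l <;> rw [Subsingleton.elim l 0]
    · exact congrFun h ((j, true), i)
    · exact congrFun h ((j, false), i)
  · ext ⟨⟨j, b⟩, i⟩
    cases b <;> rfl

theorem prob_setOf_coord_mem (S : Set ((Fin K × Bool) × Fin d → F)) :
    prob F K d _ _ {Λ : ScalarLCBC F K d | Λ.coord ∈ S} =
      S.ncard / (Nat.card F : ℝ) ^ Fintype.card ((Fin K × Bool) × Fin d) := by
  rw [prob, Nat.card_congr (Equiv.ofBijective _ coord_bijective), Nat.card_fun,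
    Nat.card_eq_fintype_card (α := _ × _), Nat.cast_pow,
    ← Set.ncard_preimage_of_injective_subset_range coord_bijective.injective
      (by rw [coord_bijective.surjective.range_eq]; exact Set.subset_univ S)]
  rfl

variable [Finite F]

theorem prob_mono {E E' : Set (LCBC F K d m m')} (h : E ⊆ E') :
    prob F K d m m' E ≤ prob F K d m m' E' := by
  simp only [prob]
  gcongr
  exact Set.toFinite _

variable [Nonempty F]

theorem prob_univ : prob F K d m m' Set.univ = 1 := by
  rw [prob, Set.ncard_univ, div_self]
  exact_mod_cast Nat.card_pos.ne'

theorem prob_compl (E : Set (LCBC F K d m m')) :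
    prob F K d m m' Eᶜ = 1 - prob F K d m m' E := by
  have hcard : (E.ncard + Eᶜ.ncard : ℝ) = Nat.card (LCBC F K d m m') :=
    mod_cast Set.ncard_add_ncard_compl E
  rw [eq_sub_iff_add_eq', prob, prob, ← add_div, hcard, div_self]
  exact_mod_cast Nat.card_pos.ne'

theorem prob_le_one (E : Set (LCBC F K d m m')) : prob F K d m m' E ≤ 1 :=
  (prob_mono (Set.subset_univ E)).trans_eq prob_univ

theorem prob_add_prob_sub_one_le_prob_inter (E E' : Set (LCBC F K d m m')) :
    prob F K d m m' E + prob F K d m m' E' - 1 ≤ prob F K d m m' (E ∩ E') := by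
  have hunion : prob F K d m m' (E ∩ E')ᶜ ≤ prob F K d m m' Eᶜ + prob F K d m m' E'ᶜ := by
    rw [Set.compl_inter, prob, prob, prob, ← add_div]
    gcongr
    exact_mod_cast Set.ncard_union_le _ _
  simp only [prob_compl] at hunion
  linarith

end Prob

section Generic

variable {p : ℕ} [Fact p.Prime] {K d : ℕ} {m m' : Fin K → ℕ}

variable (p K d m m') in
/-- The filter of the properties which a random instance over `GaloisField p n` has with probability
tending to one, as `n → ∞`. -/
def generic : Filter (Σ n, LCBC (GaloisField p n) K d m m') where
  sets := {E | Tendsto (fun n => prob (GaloisField p n) K d m m' {Λ | ⟨n, Λ⟩ ∈ E}) atTop (𝓝 1)}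
  univ_sets := by
    simp only [Set.mem_ofPred_eq, Set.mem_univ, Set.ofPred_true, prob_univ, tendsto_const_nhds]
  sets_of_superset {E E'} hE h := by
    simp only [Set.mem_ofPred_eq] at hE ⊢
    exact tendsto_of_tendsto_of_tendsto_of_le_of_le hE tendsto_const_nhds
      (fun _ => prob_mono fun _ hΛ => h hΛ) fun _ => prob_le_one _
  inter_sets {E E'} hE hE' := by
    simp only [Set.mem_ofPred_eq] at hE hE' ⊢
    have h := (hE.add hE').sub_const 1
    rw [add_sub_cancel_right] at h
    exact tendsto_of_tendsto_of_tendsto_of_le_of_le h tendsto_const_nhds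
      (fun _ => prob_add_prob_sub_one_le_prob_inter _ _) fun _ => prob_le_one _

theorem eventually_generic_iff {P : (Σ n, LCBC (GaloisField p n) K d m m') → Prop} :
    (∀ᶠ Λ in generic p K d m m', P Λ) ↔
      Tendsto (fun n => prob (GaloisField p n) K d m m' {Λ | P ⟨n, Λ⟩}) atTop (𝓝 1) :=
  Iff.rfl

theorem isGenericOptimalCost_iff_tendsto {Δ : ℝ} : IsGenericOptimalCost p K d m m' Δ ↔
    Tendsto (fun Λ => Λ.2.optimalCost) (generic p K d m m') (𝓝 Δ) := by
  rw [Metric.tendsto_nhds]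
  exact forall₂_congr fun ε _ =>
    (eventually_generic_iff (P := fun Λ => |Λ.2.optimalCost - Δ| < ε)).symm

theorem tendsto_fst_generic : Tendsto Sigma.fst (generic p K d m m') atTop := by
  refine tendsto_atTop.2 fun N => eventually_generic_iff.2 (tendsto_const_nhds.congr' ?_)
  filter_upwards [eventually_ge_atTop N] with n hn
  simp only [hn, Set.ofPred_true, prob_univ]

theorem eventually_coord_notMem {S : ∀ n, Set ((Fin K × Bool) × Fin d → GaloisField p n)}
    {b : ℕ → ℕ} (hS : ∀ᶠ n in atTop, (S n).ncard * Nat.card (GaloisField p n) ≤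
      b n * Nat.card (GaloisField p n) ^ Fintype.card ((Fin K × Bool) × Fin d))
    (hb : Tendsto (fun n => b n / (p : ℝ) ^ n) atTop (𝓝 0)) :
    ∀ᶠ Λ in generic p K d _ _, Λ.2.coord ∉ S Λ.1 := by
  have hlim := hb.const_sub 1
  rw [sub_zero] at hlim
  refine eventually_generic_iff.2 <| tendsto_of_tendsto_of_tendsto_of_le_of_le' hlim
    tendsto_const_nhds ?_ (.of_forall fun n => prob_le_one _)
  filter_upwards [hS, eventually_ne_atTop 0] with n hSn hn
  change _ ≤ prob _ _ _ _ _ {Λ : ScalarLCBC _ K d | Λ.coord ∈ S n}ᶜ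
  have hp : 0 < p := (Fact.out : p.Prime).pos
  rw [GaloisField.card p n hn] at hSn
  rw [prob_compl, prob_setOf_coord_mem, GaloisField.card p n hn]
  gcongr 1 - ?_
  rw [div_le_div_iff₀ (by positivity) (by positivity)]
  exact_mod_cast hSn

theorem eventually_aeval_coord_ne_zero {P : MvPolynomial ((Fin K × Bool) × Fin d) (ZMod p)}
    (hP : P ≠ 0) : ∀ᶠ Λ in generic p K d _ _, aeval Λ.2.coord P ≠ 0 := by
  refine eventually_coord_notMem (S := fun n => {x | aeval x P = 0}) (b := fun _ => P.totalDegree)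
    (.of_forall fun n => ?_) ?_
  · have hmap : map (algebraMap (ZMod p) (GaloisField p n)) P ≠ 0 :=
      (map_injective _ (algebraMap (ZMod p) _).injective).ne_iff' (map_zero _) |>.2 hP
    have h := ncard_eval_eq_zero_mul_card_le hmap
    simp only [eval_map, ← aeval_def] at h
    exact h.trans (Nat.mul_le_mul_right _ (Finset.sup_mono (support_map_subset _ _)))
  · exact tendsto_const_nhds.div_atTop
      (tendsto_pow_atTop_atTop_of_one_lt (mod_cast (Fact.out : p.Prime).one_lt))

theorem eventually_linearIndependent_row {ι n : Type*} [Finite ι] [Finite n]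
    (M : Matrix ι n (MvPolynomial ((Fin K × Bool) × Fin d) (ZMod p)))
    (hM : ∃ x, LinearIndependent (ZMod p) (M.map (eval x)).row) :
    ∀ᶠ Λ in generic p K d _ _,
      LinearIndependent (GaloisField p Λ.1) (M.map (aeval Λ.2.coord)).row := by
  classical
  have := Fintype.ofFinite ι
  have := Fintype.ofFinite n
  obtain ⟨x, hx⟩ := hM
  obtain ⟨N, hN⟩ := exists_mul_eq_one_of_linearIndependent_row hx
  let P : Matrix ι ι (MvPolynomial ((Fin K × Bool) × Fin d) (ZMod p)) := M * N.map C
  have hmap {S : Type} [CommRing S] (f : MvPolynomial ((Fin K × Bool) × Fin d) (ZMod p) →+* S) :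
      f P.det = (M.map f * (N.map C).map f).det := by
    rw [RingHom.map_det, RingHom.mapMatrix_apply, ← Matrix.map_mul]
    rfl
  have hP : P.det ≠ 0 := fun h => by
    have hC : (N.map C).map (eval x) = N := by
      ext
      exact eval_C _
    have hdet := hmap (eval x)
    rw [h, map_zero, hC, hN, det_one] at hdet
    exact zero_ne_one hdet
  filter_upwards [eventually_aeval_coord_ne_zero hP] with Λ hΛ
  rw [← RingHom.coe_coe, hmap] at hΛ
  exact (linearIndependent_rows_of_det_ne_zero hΛ).of_comp (vecMulLinear _)

end Generic

theorem map_userRows {K d : ℕ} {R S : Type*} (w : Fin K × Bool → Fin d → R)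
    (I : Finset (Fin K)) (f : R → S) : (userRows w I).map f = userRows (fun u l => f (w u l)) I :=
  rfl

section GenericInstances

variable {p : ℕ} [Fact p.Prime] {K d : ℕ}

theorem eventually_linearIndependent_vec_comp {ι : Type*} [Finite ι] {u : ι → Fin K × Bool}
    (hu : Function.Injective u) (hcard : Nat.card ι ≤ d) :
    ∀ᶠ Λ in generic p K d _ _, LinearIndependent (GaloisField p Λ.1) (vec Λ.2 ∘ u) := by
  have := Fintype.ofFinite ι
  obtain ⟨e⟩ : Nonempty (ι ↪ Fin d) := Function.Embedding.nonempty_of_card_le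
    (by rwa [Fintype.card_fin, ← Nat.card_eq_fintype_card])
  have h := eventually_linearIndependent_row (p := p) (of fun i l => X (u i, l))
    ⟨fun v => Function.extend u (fun i => (Pi.single (e i) 1 : Fin d → ZMod p)) 0 v.1 v.2, by
      convert (Pi.linearIndependent_single_one (Fin d) (ZMod p)).comp e e.injective using 1
      ext i l
      simp [hu.extend_apply]⟩
  refine h.mono fun Λ hΛ => ?_
  convert hΛ using 1
  ext i l
  simp [coord]

theorem eventually_card_le_optimalCost {I : Finset (Fin K)} (hI : 2 * #I ≤ d) :
    ∀ᶠ Λ in generic p K d (fun _ => 1) (fun _ => 1), (#I : ℝ) ≤ Λ.2.optimalCost := by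
  have hu : Function.Injective fun u : I × Bool => (u.1.1, u.2) :=
    Subtype.val_injective.prodMap Function.injective_id
  filter_upwards [eventually_linearIndependent_vec_comp hu (by simp; lia)] with Λ hΛ
  exact card_le_optimalCost hΛ

/-- The labelling lists `0, 1, 2, …` in pairs, except that user `s + 1` gets `2 * s + 1` and
`2 * s + 2`, and user `s + 2` gets `2 * s` and `2 * s + 2`. -/
theorem exists_overlapping_labels {s : ℕ} (hs : s + 2 < K) :
    ∃ (I J M : Finset (Fin K)) (label : Fin K × Bool → ℕ), #I + #J + #M = 2 * s + 3 ∧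
      ∀ l < 2 * s + 3, ((∃ u, u.1 ∈ I ∧ label u = l) ∨ ∃ u, u.1 ∈ J ∧ label u = l) ∧
        ((∃ u, u.1 ∈ M ∧ label u = l) ∨
          (∃ u, u.1 ∈ I ∧ label u = l) ∧ ∃ u, u.1 ∈ J ∧ label u = l) := by
  let A : Fin K := ⟨s, by lia⟩
  let B : Fin K := ⟨s + 1, by lia⟩
  let C : Fin K := ⟨s + 2, hs⟩
  let label (u : Fin K × Bool) : ℕ :=
    if u.1 ≤ A then 2 * u.1 + u.2.toNat else if u.1 = B then 2 * s + 1 + u.2.toNat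
    else 2 * s + 2 * u.2.toNat
  have hA {l : ℕ} (hl : l ≤ 2 * s + 1) : ∃ u, u.1 ≤ A ∧ u.1.1 = l / 2 ∧ label u = l := by
    have hdiv : l / 2 ≤ s := by lia
    refine ⟨(⟨l / 2, hdiv.trans_lt A.is_lt⟩, l.bodd), hdiv, rfl, ?_⟩
    simpa [label, A, hdiv, add_comm, Nat.div2_val] using l.bodd_add_div2
  have hB (b) : label (B, b) = 2 * s + 1 + b.toNat := by simp [label, A, B]
  have hC (b) : label (C, b) = 2 * s + 2 * b.toNat := by simp [label, A, B, C]
  have hI {l : ℕ} (hl : l ≤ 2 * s + 1) : ∃ u, u.1 ∈ Finset.Iic A ∧ label u = l := by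
    obtain ⟨u, huA, -, hu⟩ := hA hl
    exact ⟨u, Finset.mem_Iic.2 huA, hu⟩
  have hJ {l : ℕ} (hl : l ≠ 2 * s) (hl' : l < 2 * s + 3) :
      ∃ u, u.1 ∈ insert B (Finset.Iio A) ∧ label u = l := by
    obtain h | rfl | rfl : l < 2 * s ∨ l = 2 * s + 1 ∨ l = 2 * s + 2 := by lia
    · obtain ⟨u, -, hul, hu⟩ := hA (l := l) (by lia)
      exact ⟨u, Finset.mem_insert_of_mem (Finset.mem_Iio.2 (Fin.lt_def.2 (by lia))), hu⟩
    · exact ⟨(B, false), Finset.mem_insert_self _ _, hB false⟩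
    · exact ⟨(B, true), Finset.mem_insert_self _ _, hB true⟩
  refine ⟨Finset.Iic A, insert B (Finset.Iio A), {C}, label, ?_, fun l hl => ⟨?_, ?_⟩⟩
  · rw [Finset.card_insert_of_notMem (by simp [A, B]), Fin.card_Iic, Fin.card_Iio,
      Finset.card_singleton]
    lia
  · rcases le_or_gt l (2 * s + 1) with h | h
    · exact .inl (hI h)
    · exact .inr (hJ (by lia) hl)
  · obtain rfl | rfl | h : l = 2 * s ∨ l = 2 * s + 2 ∨ l ≠ 2 * s ∧ l ≤ 2 * s + 1 := by lia
    · exact .inl ⟨(C, false), Finset.mem_singleton_self C, hC false⟩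
    · exact .inl ⟨(C, true), Finset.mem_singleton_self C, hC true⟩
    · exact .inr ⟨hI h.2, hJ h.1 hl⟩

theorem exists_linearIndependent_row_overlapMatrix (F : Type*) [Field F] {s : ℕ} (hs : s + 2 < K) :
    ∃ (I J M : Finset (Fin K)) (w : Fin K × Bool → Fin (2 * s + 3) → F),
      #I + #J + #M = 2 * s + 3 ∧
        LinearIndependent F (overlapMatrix (userRows w I) (userRows w J) (userRows w M)).row := by
  obtain ⟨I, J, M, label, hcard, hlabel⟩ := exists_overlapping_labels hs
  let w (u : Fin K × Bool) (l : Fin (2 * s + 3)) : F := if l = label u then 1 else 0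
  have hw {I : Finset (Fin K)} {l : Fin (2 * s + 3)} (h : ∃ u, u.1 ∈ I ∧ label u = l) :
      Pi.single l 1 ∈ Submodule.span F (Set.range (userRows w I).row) := by
    obtain ⟨u, hu, hul⟩ := h
    refine Submodule.subset_span ⟨(⟨u.1, hu⟩, u.2), ?_⟩
    ext i
    simp [userRows, w, hul, Fin.val_inj, Pi.single_apply]
  refine ⟨I, J, M, w, hcard, (linearIndependent_row_overlapMatrix_iff (by simp; lia)).2
    ⟨eq_top_of_single_one_mem fun l => ?_, eq_top_of_single_one_mem fun l => ?_⟩⟩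
  · rcases (hlabel l l.is_lt).1 with h | h
    · exact Submodule.mem_sup_left (hw h)
    · exact Submodule.mem_sup_right (hw h)
  · rcases (hlabel l l.is_lt).2 with h | ⟨h, h'⟩
    · exact Submodule.mem_sup_left (hw h)
    · exact Submodule.mem_sup_right ⟨hw h, hw h'⟩

theorem eventually_half_le_optimalCost (hd : Odd d) (hd3 : 3 ≤ d) (hdK : d < 2 * K - 1) :
    ∀ᶠ Λ in generic p K d (fun _ => 1) (fun _ => 1), (d : ℝ) / 2 ≤ Λ.2.optimalCost := by
  obtain ⟨s, rfl⟩ : ∃ s, d = 2 * s + 3 := ⟨(d - 3) / 2, by grind⟩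
  obtain ⟨I, J, M, w, hcard, hw⟩ :=
    exists_linearIndependent_row_overlapMatrix (K := K) (s := s) (ZMod p) (by lia)
  let vars (u : Fin K × Bool) (l : Fin (2 * s + 3)) :
      MvPolynomial ((Fin K × Bool) × Fin (2 * s + 3)) (ZMod p) := X (u, l)
  have h := eventually_linearIndependent_row
    (overlapMatrix (userRows vars I) (userRows vars J) (userRows vars M))
    ⟨fun v => w v.1 v.2, by simpa only [map_overlapMatrix, map_userRows, vars, eval_X] using hw⟩
  filter_upwards [h] with Λ hΛ
  refine half_le_optimalCost hcard ?_
  simpa only [map_overlapMatrix, map_userRows, vars, aeval_X, coord] using hΛ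

end GenericInstances

section GenericAlignment

variable {p : ℕ} [Fact p.Prime] {K d : ℕ}

theorem tendsto_pow_mul_div_pow_zero {N b : ℕ → ℕ} (c : ℕ) (hN : Tendsto N atTop atTop)
    (hb : ∀ᶠ n in atTop, b n + N n ≤ n) :
    Tendsto (fun n => ((p ^ b n * (c * N n) : ℕ) : ℝ) / (p : ℝ) ^ n) atTop (𝓝 0) := by
  have hp : 1 < p := (Fact.out : p.Prime).one_lt
  have hlim := ((tendsto_pow_const_div_const_pow_of_one_lt 1 (r := (p : ℝ))
    (mod_cast hp)).comp hN).const_mul (c : ℝ)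
  rw [mul_zero] at hlim
  refine squeeze_zero' (.of_forall fun n => by positivity) ?_ hlim
  filter_upwards [hb] with n hn
  calc ((p ^ b n * (c * N n) : ℕ) : ℝ) / (p : ℝ) ^ n
      ≤ ((p ^ b n * (c * N n) : ℕ) : ℝ) / (p : ℝ) ^ (b n + N n) := by
        have hp' : (1 : ℝ) ≤ p := mod_cast hp.le
        gcongr
    _ = _ := by
        push_cast
        rw [pow_add, mul_div_mul_left _ _ (by positivity), Function.comp_apply, pow_one,
          mul_div_assoc]

theorem eventually_linearIndependent_gridMonomial {N : ℕ → ℕ} (hN : Tendsto N atTop atTop)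
    (hn : ∀ᶠ n in atTop, 2 * N n ^ Fintype.card ((Fin K × Fin 2) × Fin d) + N n ≤ n)
    {r : ∀ n, Fin 2 → GaloisField p n}
    (hr : ∀ᶠ n in atTop, LinearIndependent (ZMod p) (r n)) :
    ∀ᶠ Λ in generic p K d _ _, LinearIndependent (ZMod p)
      fun u : Fin 2 × ((Fin K × Fin 2) × Fin d → Fin (N Λ.1)) =>
        r Λ.1 u.1 * gridMonomial (mix (r Λ.1) (coord Λ.2)) u.2 := by
  set τ := Fintype.card ((Fin K × Fin 2) × Fin d)
  have heval {n} (x : (Fin K × Bool) × Fin d → GaloisField p n)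
      (u : Fin 2 × ((Fin K × Fin 2) × Fin d → Fin (N n))) :
      eval x (C (r n u.1) * gridMonomial (mix (C ∘ r n) X) u.2) =
        r n u.1 * gridMonomial (mix (r n) x) u.2 := by
    have hC : eval x ∘ C ∘ r n = r n := funext fun i => eval_C _
    have hX : eval x ∘ X = x := funext fun v => eval_X v
    rw [map_mul, eval_C, map_gridMonomial, map_comp_mix, hC, hX]
  have hbad := eventually_coord_notMem (p := p) (S := fun n =>
      {x : (Fin K × Bool) × Fin d → GaloisField p n | ¬ LinearIndependent (ZMod p)
        fun u : Fin 2 × ((Fin K × Fin 2) × Fin d → Fin (N n)) =>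
          r n u.1 * gridMonomial (mix (r n) x) u.2})
    (b := fun n => p ^ (2 * N n ^ τ) * (τ * N n)) ?_ (tendsto_pow_mul_div_pow_zero τ hN hn)
  · exact hbad.mono fun Λ hΛ => not_not.1 hΛ
  filter_upwards [hr] with n hr
  have h := ncard_not_linearIndependent_eval_mul_card_le (D := τ * N n)
    (linearIndependent_C_mul_gridMonomial_mix (K := K) (d := d) hr (N n)) fun u =>
      (totalDegree_mul _ _).trans <| by
        rw [totalDegree_C, zero_add]
        exact totalDegree_gridMonomial_le (totalDegree_mix_le _) _
  simp only [heval] at h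
  convert h using 3
  simp [τ]

theorem exists_tendsto_half_eventually_optimalCost_le (hK : 1 ≤ K) (hd : 1 ≤ d) :
    ∃ f : ℕ → ℝ, Tendsto f atTop (𝓝 (d / 2)) ∧
      ∀ᶠ Λ in generic p K d (fun _ => 1) (fun _ => 1), Λ.2.optimalCost ≤ f Λ.1 := by
  have hτ : 2 ≤ Fintype.card ((Fin K × Fin 2) × Fin d) := by
    simp only [Fintype.card_prod, Fintype.card_fin]
    nlinarith
  obtain ⟨N, hN, hn, hlim, hlim'⟩ := exists_tendsto_pow_div_half hτ
  have hr (n) : ∃ r : Fin 2 → GaloisField p n, 1 < n → LinearIndependent (ZMod p) r := by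
    by_cases hn : 1 < n
    · obtain ⟨y, hy⟩ := exists_linearIndependent_pair_of_one_lt_finrank (R := ZMod p)
        (by rwa [GaloisField.finrank p (by lia)]) (one_ne_zero (α := GaloisField p n))
      exact ⟨_, fun _ => hy⟩
    · exact ⟨0, fun h => absurd h hn⟩
  choose r hr using hr
  have hf := (hlim'.const_mul (d : ℝ)).add (((hlim.const_mul 2).const_sub 1).const_mul (K : ℝ))
  refine ⟨_, by convert hf using 2; ring, ?_⟩
  filter_upwards [eventually_linearIndependent_gridMonomial hN hn
    ((eventually_gt_atTop 1).mono hr), tendsto_fst_generic.eventually_ne_atTop 0] with Λ hΛ hn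
  have h := optimalCost_le_of_linearIndependent_gridMonomial hΛ
  rwa [GaloisField.finrank p hn] at h

theorem isGenericOptimalCost_half (hK : 1 ≤ K) (hd : 1 ≤ d)
    (h : ∀ᶠ Λ in generic p K d (fun _ => 1) (fun _ => 1), (d : ℝ) / 2 ≤ Λ.2.optimalCost) :
    IsGenericOptimalCost p K d (fun _ => 1) (fun _ => 1) ((d : ℝ) / 2) := by
  obtain ⟨f, hf, hle⟩ := exists_tendsto_half_eventually_optimalCost_le (p := p) hK hd
  exact isGenericOptimalCost_iff_tendsto.2 <| tendsto_of_tendsto_of_tendsto_of_le_of_le'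
    tendsto_const_nhds (hf.comp tendsto_fst_generic) h hle

end GenericAlignment

section Regimes

variable {p : ℕ} [Fact p.Prime] {K d : ℕ}

theorem isGenericOptimalCost_of_eventually_eq {m m' : Fin K → ℕ} {Δ : ℝ}
    (hle : ∀ᶠ Λ in generic p K d m m', Λ.2.optimalCost ≤ Δ)
    (hge : ∀ᶠ Λ in generic p K d m m', Δ ≤ Λ.2.optimalCost) :
    IsGenericOptimalCost p K d m m' Δ :=
  isGenericOptimalCost_iff_tendsto.2 <| tendsto_const_nhds.congr' <| by
    filter_upwards [hle, hge] with Λ h h' using le_antisymm h' h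

theorem isGenericOptimalCost_zero :
    IsGenericOptimalCost p K 1 (fun _ => 1) (fun _ => 1) 0 := by
  have hne (j : Fin K) : ∀ᶠ Λ in generic p K 1 _ _, vec Λ.2 (j, false) ≠ 0 :=
    (eventually_linearIndependent_vec_comp (u := fun _ : Fin 1 => (j, false))
      (Function.injective_of_subsingleton _) (by simp)).mono fun Λ h => h.ne_zero 0
  refine isGenericOptimalCost_iff_tendsto.2 (tendsto_const_nhds.congr' ?_)
  filter_upwards [eventually_all.2 hne] with Λ hΛ
  refine (optimalCost_eq_zero_of_mem_span fun j => ?_).symm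
  obtain ⟨c, hc⟩ :=
    exists_smul_eq_of_finrank_eq_one (Module.finrank_fin_fun _) (hΛ j) (vec Λ.2 (j, true))
  exact Submodule.mem_span_singleton.2 ⟨c, hc⟩

theorem isGenericOptimalCost_card_users_sub_one (hK : 1 ≤ K) (hd : d = 2 * K - 1) :
    IsGenericOptimalCost p K d (fun _ => 1) (fun _ => 1) ((K : ℝ) - 1) := by
  obtain ⟨I, -, hI⟩ := Finset.exists_subset_card_eq (s := (Finset.univ : Finset (Fin K)))
    (n := K - 1) (by simp)
  have hge := eventually_card_le_optimalCost (p := p) (d := d) (I := I) (by lia)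
  rw [hI, Nat.cast_sub hK, Nat.cast_one] at hge
  refine isGenericOptimalCost_of_eventually_eq ?_ hge
  have hind (j : Fin K) := eventually_linearIndependent_vec_comp (p := p) (d := d)
    (u := ((↑) : ↥({(j, true)}ᶜ : Finset (Fin K × Bool)) → Fin K × Bool))
    Subtype.val_injective (by simp; lia)
  filter_upwards [eventually_all.2 hind] with Λ hΛ
  exact optimalCost_le_card_users_sub_one hK (by lia) hΛ

theorem isGenericOptimalCost_card_users (hd : 2 * K ≤ d) :
    IsGenericOptimalCost p K d (fun _ => 1) (fun _ => 1) (K : ℝ) := by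
  have hge := eventually_card_le_optimalCost (p := p) (d := d) (I := (Finset.univ : Finset (Fin K)))
    (by simpa using hd)
  rw [Finset.card_fin] at hge
  exact isGenericOptimalCost_of_eventually_eq (.of_forall fun Λ => optimalCost_le_card_users) hge

theorem isGenericOptimalCost_half_of_even (hd : Even d) (hd₀ : 1 ≤ d) (hdK : d ≤ 2 * K) :
    IsGenericOptimalCost p K d (fun _ => 1) (fun _ => 1) ((d : ℝ) / 2) := by
  obtain ⟨n, rfl⟩ := hd.two_dvd
  obtain ⟨I, -, hI⟩ := Finset.exists_subset_card_eq (s := (Finset.univ : Finset (Fin K)))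
    (n := n) (by simp; lia)
  have hge := eventually_card_le_optimalCost (p := p) (d := 2 * n) (I := I) (by lia)
  refine isGenericOptimalCost_half (by lia) hd₀ ?_
  simpa [hI] using hge

theorem isGenericOptimalCost_half_of_odd (hd : Odd d) (hd3 : 3 ≤ d) (hdK : d < 2 * K - 1) :
    IsGenericOptimalCost p K d (fun _ => 1) (fun _ => 1) ((d : ℝ) / 2) :=
  isGenericOptimalCost_half (by lia) (by lia) (eventually_half_le_optimalCost hd hd3 hdK)

end Regimes

end LCBC

end

theorem theorem3 (p : ℕ) [Fact p.Prime] (K d : ℕ) (hK : 1 ≤ K) :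
    (Even d →
      (2 ≤ d → d ≤ 2 * K →
        LCBC.IsGenericOptimalCost p K d (fun _ => 1) (fun _ => 1) ((d : ℝ) / 2)) ∧
      (2 * K ≤ d →
        LCBC.IsGenericOptimalCost p K d (fun _ => 1) (fun _ => 1) (K : ℝ))) ∧
    (Odd d →
      (d = 1 →
        LCBC.IsGenericOptimalCost p K d (fun _ => 1) (fun _ => 1) 0) ∧
      (3 ≤ d → d < 2 * K - 1 →
        LCBC.IsGenericOptimalCost p K d (fun _ => 1) (fun _ => 1) ((d : ℝ) / 2)) ∧
      (d = 2 * K - 1 →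
        LCBC.IsGenericOptimalCost p K d (fun _ => 1) (fun _ => 1) ((K : ℝ) - 1)) ∧
      (2 * K - 1 < d →
        LCBC.IsGenericOptimalCost p K d (fun _ => 1) (fun _ => 1) (K : ℝ))) := by
  refine ⟨fun hd => ⟨fun hd₂ hdK => ?_, fun hdK => ?_⟩,
    fun hd => ⟨fun hd₁ => ?_, fun hd₃ hdK => ?_, fun hdK => ?_, fun hdK => ?_⟩⟩
  · exact LCBC.isGenericOptimalCost_half_of_even hd (by lia) hdK
  · exact LCBC.isGenericOptimalCost_card_users hdK
  · subst hd₁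
    exact LCBC.isGenericOptimalCost_zero
  · exact LCBC.isGenericOptimalCost_half_of_odd hd hd₃ hdK
  · exact LCBC.isGenericOptimalCost_card_users_sub_one hK hdK
  · exact LCBC.isGenericOptimalCost_card_users (by lia)
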